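/- Let $M$ be a lattice of rank $d$ with dual lattice $N$, and let $\Lambda\subset M$ be a finitely generated subsemigroup (with $0$) which generates $M$ as a group and such that the cone $\sigma^\vee=\mathbf R_{\ge 0}\Lambda\subset M_{\mathbf R}$ is strictly convex. Let $\sigma\subset N_{\mathbf R}$ be the dual cone, $\stackrel{\circ}{\sigma}$ its interior, and $e_1,\dots,e_n$ the minimal set of generators of $\Lambda$. For $0\le k\le d$ let $\mathcal J_k\subset\Lambda$ be the set of all sums $e_{i_1}+\cdots+e_{i_k}$ with $i_1<\cdots<i_k$ and $e_{i_1},\dots,e_{i_k}$ linearly independent; let $\mathcal N(\mathcal J_k)\subset M_{\mathbf R}$ be its Newton polyhedron, i.e. the convex hull of $\mathcal J_k+\sigma^\vee$. For $\nu\in\sigma$ put $\mathrm{ord}_{\mathcal J_k}(\nu)=\inf_{\omega\in\mathcal N(\mathcal J_k)}\langle\nu,\omega\rangle$; the face of $\mathcal N(\mathcal J_k)$ defined by $\nu$ is $\{\omega\in\mathcal N(\mathcal J_k)\mid\langle\nu,\omega\rangle=\mathrm{ord}_{\mathcal J_k}(\nu)\}$. Put $\phi_0=0$, $\phi_{d+1}=+\infty$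 and, if $d\ge 1$, $\phi_1=\mathrm{ord}_{\mathcal J_1}$ and $\phi_k=\mathrm{ord}_{\mathcal J_k}-\mathrm{ord}_{\mathcal J_{k-1}}$ for $2\le k\le d$. For $0\le k\le d$ let $A_k$ be the set of pairs $(\nu,s)$ with $\nu\in\stackrel{\circ}{\sigma}\cap N$, $s\in\mathbf Z_{\ge0}$ and $\phi_k(\nu)\le s<\phi_{k+1}(\nu)$. For $(\nu,s),(\nu',s')\in A_k$ write $(\nu,s)\sim(\nu',s')$ if $s=s'$ and, for all $1\le j\le k$, $\nu$ and $\nu'$ define the same face of $\mathcal N(\mathcal J_j)$ and $\mathrm{ord}_{\mathcal J_j}(\nu)=\mathrm{ord}_{\mathcal J_j}(\nu')$. Let $\ell_\nu^s\subset M_{\mathbf Q}$ be the $\mathbf Q$-linear span of the $e_i$ with $\langle\nu,e_i\rangle\le s$. Let $Z^\Lambda=\mathrm{Spec}\,\mathbf C[\Lambda]$, let $0\in Z^\Lambda$ be the point where all $X^u$ with $0\ne u\in\Lambda$ vanish, and let $T_N=\mathrm{Spec}\,\mathbf C[M]$ be its torus. Let $H^*$ be the set of arcs $h:\mathrm{Spec}\,\mathbf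 C[[t]]\to Z^\Lambda$ with origin $0$ and with generic point in $T_N$. For $\nu\in\stackrel{\circ}{\sigma}\cap N$ let $H^*_\nu$ be the set of $h\in H^*$ such that, for all $m\in M$, the Laurent series $X^m\circ h$ has order $\langle\nu,m\rangle$ in $t$. Let $j_s$ send an arc to its $s$-jet $\mathrm{Spec}\,\mathbf C[t]/(t^{s+1})\to Z^\Lambda$. If $0\le k\le d$ and $(\nu,s),(\nu',s)\in A_k$, the following are equivalent: (i) $(\nu,s)\sim(\nu',s)$; (ii) $\ell_\nu^s=\ell_{\nu'}^s$, and $\nu$ and $\nu'$ have the same restriction to this space; (iii) $j_s(H^*_\nu)=j_s(H^*_{\nu'})$; (iv) $j_s(H^*_\nu)\cap j_s(H^*_{\nu'})\neq\emptyset$. Moreover, for all $\nu,\nu'\in\stackrel{\circ}{\sigma}\cap N$ and all integers $s\ge 0$, the sets $j_s(H^*_\nu)$ and $j_s(H^*_{\nu'})$ are either equal or disjoint. -/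

import Mathlib

open scoped TensorProduct

noncomputable section

namespace ToricJets

section Lattice

variable (M : Type*) [AddCommGroup M]

/-- The real vector space `M_ℝ = M ⊗ ℝ` of a lattice `M`. -/
abbrev MReal : Type _ := ℝ ⊗[ℤ] M

/-- The rational vector space `M_ℚ = M ⊗ ℚ` of a lattice `M`. -/
abbrev MRat : Type _ := ℚ ⊗[ℤ] M

/-- The dual lattice `N` of `M`. -/
abbrev NLat : Type _ := Module.Dual ℤ M

/-- The real vector space `N_ℝ`, as the dual of `M_ℝ`. -/
abbrev NReal : Type _ := Module.Dual ℝ (MReal M)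

variable {M}

/-- The image `1 ⊗ m` of a lattice vector in `M_ℝ`. -/
def toMReal (m : M) : MReal M := (1 : ℝ) ⊗ₜ[ℤ] m

/-- The image `1 ⊗ m` of a lattice vector in `M_ℚ`. -/
def toMRat (m : M) : MRat M := (1 : ℚ) ⊗ₜ[ℤ] m

/-- The inclusion `N → N_ℝ`: extension of an integral linear form to `M_ℝ`. -/
def toNReal (ν : NLat M) : NReal M := Module.Dual.baseChange ℝ ν

/-- Extension of an integral linear form to a `ℚ`-linear form on `M_ℚ`. -/
def toNRat (ν : NLat M) : Module.Dual ℚ (MRat M) := Module.Dual.baseChange ℚ ν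

end Lattice

section Semigroup

variable {M : Type*} [AddCommGroup M] (Λ : AddSubmonoid M)

/-- The cone `σ^∨ = ℝ_{≥0} Λ` in `M_ℝ`. -/
def dualCone : PointedCone ℝ (MReal M) := PointedCone.hull ℝ (toMReal '' (Λ : Set M))

/-- The cone `σ ⊆ N_ℝ` dual to `σ^∨`. -/
def sigma : Set (NReal M) := {x | ∀ w ∈ dualCone Λ, 0 ≤ x w}

/-- The interior of `σ`, for the usual topology of the finite-dimensional real vector space
`N_ℝ`. When `σ^∨` is strictly convex the cone `σ` is full-dimensional, so this is also its
relative interior. -/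
def sigmaInterior : Set (NReal M) := @interior (NReal M) (moduleTopology ℝ (NReal M)) (sigma Λ)

/-- `Λ` is a semigroup of finite type which generates the lattice `M` as a group and spans a
strictly convex cone (a cone containing no line through the origin). The cone then automatically
has dimension the rank of `M`. -/
structure IsToricSemigroup : Prop where
  fg : Λ.FG
  generates : AddSubgroup.closure (Λ : Set M) = ⊤
  strictlyConvex : ∀ w : MReal M, w ∈ dualCone Λ → -w ∈ dualCone Λ → w = 0

/-- `e₁, …, eₙ` enumerates, without repetition, a minimal set of generators of `Λ`. -/
structure IsMinimalGenerators {n : ℕ} (e : Fin n → M) : Prop where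
  injective : Function.Injective e
  closure_eq : AddSubmonoid.closure (Set.range e) = Λ
  minimal : ∀ S : Set M, S ⊆ Set.range e → AddSubmonoid.closure S = Λ → S = Set.range e

/-- The Newton polyhedron of `I ⊆ Λ`: the convex hull of `I + σ^∨` in `M_ℝ`. -/
def newtonPolyhedron (I : Set M) : Set (MReal M) :=
  convexHull ℝ {w | ∃ m ∈ I, ∃ v ∈ dualCone Λ, w = toMReal m + v}

/-- The support function `ord_I` of the Newton polyhedron of `I`, `ν ↦ inf ⟨ν, ω⟩`. -/
def ordIdeal (I : Set M) (x : NReal M) : ℝ :=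
  sInf ((fun w => x w) '' newtonPolyhedron Λ I)

/-- The face of the Newton polyhedron of `I` determined by `x ∈ σ`. -/
def newtonFace (I : Set M) (x : NReal M) : Set (MReal M) :=
  {w | w ∈ newtonPolyhedron Λ I ∧ x w = ordIdeal Λ I x}

variable {n : ℕ} (e : Fin n → M)

/-- The set of exponents defining the `k`-th logarithmic jacobian ideal: the sums of `k` linearly
independent vectors among `e₁, …, eₙ`. -/
def logJac (k : ℕ) : Set M :=
  {m | ∃ I : Finset (Fin n), I.card = k ∧ LinearIndependent ℤ (fun i : I => e i) ∧
    m = ∑ i ∈ I, e i}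

/-- `ord_{J_k}`. -/
def ordJ (k : ℕ) (x : NReal M) : ℝ := ordIdeal Λ (logJac e k) x

/-- The functions `φ₀ = 0`, `φ₁ = ord_{J₁}`, `φ_k = ord_{J_k} - ord_{J_{k-1}}` for
`2 ≤ k ≤ d`, and `φ_{d+1} = +∞`, where `d` is the rank of `M`. -/
def phi (k : ℕ) (x : NReal M) : EReal :=
  if Module.finrank ℤ M < k then ⊤
  else if k = 0 then 0
  else if k = 1 then (ordJ Λ e 1 x : EReal)
  else ((ordJ Λ e k x - ordJ Λ e (k - 1) x : ℝ) : EReal)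

/-- `A_k`: the pairs `(ν, s)` with `ν` a lattice vector in the interior of `σ` and
`φ_k(ν) ≤ s < φ_{k+1}(ν)`. -/
def A (k : ℕ) : Set (NLat M × ℕ) :=
  {p | toNReal p.1 ∈ sigmaInterior Λ ∧
    phi Λ e k (toNReal p.1) ≤ ((p.2 : ℝ) : EReal) ∧
    ((p.2 : ℝ) : EReal) < phi Λ e (k + 1) (toNReal p.1)}

/-- The equivalence `(ν, s) ∼ (ν', s')` on `A_k`: `s = s'`, and for `1 ≤ j ≤ k` the vectors `ν`
and `ν'` define the same face of the Newton polyhedron of `J_j` and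
`ord_{J_j}(ν) = ord_{J_j}(ν')`. -/
def Equivalent (k : ℕ) (p q : NLat M × ℕ) : Prop :=
  p.2 = q.2 ∧ ∀ j : ℕ, 1 ≤ j → j ≤ k →
    newtonFace Λ (logJac e j) (toNReal p.1) = newtonFace Λ (logJac e j) (toNReal q.1) ∧
    ordJ Λ e j (toNReal p.1) = ordJ Λ e j (toNReal q.1)

/-- The linear subspace `ℓ_ν^s` of `M_ℚ` spanned by the `e_i` with `⟨ν, e_i⟩ ≤ s`. -/
def ell (ν : NLat M) (s : ℕ) : Submodule ℚ (MRat M) :=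
  Submodule.span ℚ {x | ∃ i : Fin n, ν (e i) ≤ (s : ℤ) ∧ x = toMRat (e i)}

end Semigroup

section Arcs

variable {M : Type*} [AddCommGroup M] (Λ : AddSubmonoid M)

/-- Arcs on `Z^Λ = Spec ℂ[Λ]`: the morphisms `Spec ℂ⟦t⟧ → Z^Λ`. -/
abbrev Arc : Type _ := AddMonoidAlgebra ℂ Λ →ₐ[ℂ] PowerSeries ℂ

/-- The ring `ℂ⟦t⟧ / (t^{s+1}) = ℂ[t] / (t^{s+1})`. -/
abbrev TruncatedSeries (s : ℕ) : Type :=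
  PowerSeries ℂ ⧸ Ideal.span {(PowerSeries.X : PowerSeries ℂ) ^ (s + 1)}

/-- `s`-jets on `Z^Λ`: the morphisms `Spec ℂ[t]/(t^{s+1}) → Z^Λ`. -/
abbrev Jet (s : ℕ) : Type _ := AddMonoidAlgebra ℂ Λ →ₐ[ℂ] TruncatedSeries s

variable {Λ}

/-- The `s`-jet of an arc. -/
def jet (s : ℕ) (h : Arc Λ) : Jet Λ s :=
  (Ideal.Quotient.mkₐ ℂ (Ideal.span {(PowerSeries.X : PowerSeries ℂ) ^ (s + 1)})).comp h

/-- The series `X^u ∘ h`, for `u ∈ Λ`. -/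
def pull (h : Arc Λ) (u : Λ) : PowerSeries ℂ := h (AddMonoidAlgebra.single u 1)

/-- The morphism `g : Spec ℂ((t)) → T_N = Spec ℂ[M]` is the restriction of the arc `h` to the
generic point of `Spec ℂ⟦t⟧`. -/
def IsGenericPart (h : Arc Λ) (g : AddMonoidAlgebra ℂ M →ₐ[ℂ] LaurentSeries ℂ) : Prop :=
  ∀ u : Λ, g (AddMonoidAlgebra.single (u : M) 1) = HahnSeries.ofPowerSeries ℤ ℂ (pull h u)

variable (Λ)

/-- `H_Λ`: the arcs with origin at the distinguished point `0`, the point of `Z^Λ` where all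
`X^u` with `0 ≠ u ∈ Λ` vanish. -/
def ArcsAtOrigin : Set (Arc Λ) :=
  {h | ∀ u : Λ, u ≠ 0 → PowerSeries.constantCoeff (pull h u) = 0}

/-- `H^*_Λ`: the arcs of `H_Λ` with generic point in the torus `T_N`. -/
def HStar : Set (Arc Λ) := {h | h ∈ ArcsAtOrigin Λ ∧ ∃ g, IsGenericPart h g}

/-- `H^*_ν`: the arcs `h ∈ H^*_Λ` with `ν_h = ν`, where `ν_h(m)` is the order in `t` of the
Laurent series `X^m ∘ h`, for `m ∈ M`. -/
def HStarOrbit (ν : NLat M) : Set (Arc Λ) :=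
  {h | h ∈ HStar Λ ∧ ∃ g, IsGenericPart h g ∧
    ∀ m : M, (g (AddMonoidAlgebra.single m 1)).order = ν m}

/-- The set `j_s(H^*_ν)` of `s`-jets. -/
def jetOrbit (s : ℕ) (ν : NLat M) : Set (Jet Λ s) := jet s '' HStarOrbit Λ ν

end Arcs

end ToricJets

end

noncomputable section

namespace ToricJets

/-! ### Independent subfamilies of minimal weight. -/

section MinWeight

variable {K V ι : Type*} [Field K] [AddCommGroup V] [Module K V] {v : ι → V}

/-! Everything passes through one condition, `AgreeUpTo`: the two forms agree on each `e i` where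
either is at most `s`. This is (ii) in terms of generators (`agreeUpTo_iff`).

Combinatorial half: give `e i` the weight `ν (e i)`. Then `ord_{J_k}(ν)` is the least weight of an
independent `k`-subset, and by the greedy (matroid) principle `φ_k(ν)` is the `k`-th successive
minimum. Hence `(ν, s) ∈ A_k` forces `dim ℓ_ν^s = k` (`finrank_ell_eq`). Equal faces and orders for
`j ≤ k` mean that `ν` and `ν'` give the same weight to each `ν`-minimal `j`-set; removing heaviest
elements one at a time recovers the individual values (`IsMinWeight.eq_on`). Conversely, minimal
sets of size at most `k` only involve vectors of weight at most `s`, so agreement up to `s`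
preserves them.

Geometric half: multiplying an arc by the one-parameter subgroup of `ν' - ν` preserves the
coordinates on which the forms agree, and the other generators vanish modulo `t^(s+1)` on both sides
(`AgreeUpTo.jetOrbit_subset`). Conversely, a jet determines every order that is at most `s`
(`order_le_of_jet_eq`). -/

lemma finrank_span_image_of_linearIndepOn {I : Finset ι} (hI : LinearIndepOn K v (I : Set ι)) :
    Module.finrank K (Submodule.span K (v '' I)) = I.card := by
  have h := finrank_span_eq_card (R := K) (b := fun i : (I : Set ι) => v i) hI
  rw [Set.image_eq_range]
  simpa using h

/-- The exchange property of linearly independent families. -/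
lemma exists_linearIndepOn_insert [DecidableEq ι] {I : Finset ι}
    (hI : LinearIndepOn K v (I : Set ι)) {T : Set ι}
    (hT : I.card < Module.finrank K (Submodule.span K (v '' T))) :
    ∃ j ∈ T, j ∉ I ∧ LinearIndepOn K v (insert j I : Finset ι) := by
  by_contra! hcon
  have hle : Submodule.span K (v '' T) ≤ Submodule.span K (v '' I) := by
    rw [Submodule.span_le]
    rintro _ ⟨j, hj, rfl⟩
    by_contra hj'
    have hjI : j ∉ I := fun h => hj' (Submodule.subset_span ⟨j, h, rfl⟩)
    refine hcon j hj hjI ?_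
    rw [Finset.coe_insert]
    exact hI.insert hj'
  have : FiniteDimensional K (Submodule.span K (v '' (I : Set ι))) :=
    FiniteDimensional.span_of_finite K (I.finite_toSet.image v)
  have h := Submodule.finrank_mono hle
  rw [finrank_span_image_of_linearIndepOn hI] at h
  omega

lemma exists_linearIndepOn_card [DecidableEq ι] {T : Set ι} {k : ℕ}
    (hk : k ≤ Module.finrank K (Submodule.span K (v '' T))) :
    ∃ I : Finset ι, I.card = k ∧ LinearIndepOn K v (I : Set ι) := by
  induction k with
  | zero => exact ⟨∅, rfl, by simp⟩
  | succ k ih =>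
    obtain ⟨I, rfl, hI⟩ := ih (by omega)
    obtain ⟨j, -, hj, hI'⟩ := exists_linearIndepOn_insert hI hk
    exact ⟨_, Finset.card_insert_of_notMem hj, hI'⟩

lemma LinearIndepOn.erase [DecidableEq ι] {I : Finset ι} (hI : LinearIndepOn K v (I : Set ι))
    (i : ι) : LinearIndepOn K v (I.erase i : Set ι) :=
  _root_.LinearIndepOn.mono hI (by exact_mod_cast I.erase_subset i)

variable (K v) in
/-- `I` indexes a linearly independent subfamily which has minimal weight among the linearly
independent subfamilies of the same size. -/
def IsMinWeight (w : ι → ℤ) (I : Finset ι) : Prop :=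
  LinearIndepOn K v (I : Set ι) ∧ ∀ J : Finset ι, LinearIndepOn K v (J : Set ι) →
    J.card = I.card → ∑ i ∈ I, w i ≤ ∑ i ∈ J, w i

lemma exists_isMinWeight [Fintype ι] (w : ι → ℤ) {k : ℕ}
    (hk : ∃ I : Finset ι, I.card = k ∧ LinearIndepOn K v (I : Set ι)) :
    ∃ I : Finset ι, I.card = k ∧ IsMinWeight K v w I := by
  classical
  obtain ⟨I, hI⟩ := hk
  obtain ⟨J, hJ, hmin⟩ := Finset.exists_min_image
    ({I | I.card = k ∧ LinearIndepOn K v (I : Set ι)} : Finset (Finset ι))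
    (fun I => ∑ i ∈ I, w i) ⟨I, by simpa using hI⟩
  simp only [Finset.mem_filter, Finset.mem_univ, true_and] at hJ hmin
  exact ⟨J, hJ.1, hJ.2, fun L hL hc => hmin L ⟨hc.trans hJ.1, hL⟩⟩

namespace IsMinWeight

variable [DecidableEq ι] {w w' : ι → ℤ} {I J : Finset ι}

/-- An element heavier than `s` could be exchanged for one of weight at most `s`, lowering the
total. -/
lemma le_of_mem (hI : IsMinWeight K v w I) {s : ℤ}
    (hs : I.card ≤ Module.finrank K (Submodule.span K (v '' {i | w i ≤ s}))) {i : ι} (hi : i ∈ I) :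
    w i ≤ s := by
  by_contra! hlt
  have hc := Finset.card_erase_add_one hi
  obtain ⟨j, hj, hjI, hind⟩ := exists_linearIndepOn_insert (LinearIndepOn.erase hI.1 i)
    (T := {i | w i ≤ s}) (by omega)
  have h := hI.2 _ hind (by rw [Finset.card_insert_of_notMem hjI, hc])
  rw [Finset.sum_insert hjI, ← Finset.add_sum_erase I w hi] at h
  have : w j ≤ s := hj
  omega

/-- Removing an element of maximal weight preserves minimality. -/
lemma erase (hI : IsMinWeight K v w I) {i : ι} (hi : i ∈ I) (hmax : ∀ j ∈ I, w j ≤ w i) :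
    IsMinWeight K v w (I.erase i) := by
  refine ⟨LinearIndepOn.erase hI.1 i, fun J hJ hc => ?_⟩
  have hc' := Finset.card_erase_add_one hi
  -- A competitor `J` extends by some `j ∈ I`; since `w j ≤ w i`, minimality of `I` passes to the
  -- erased set.
  obtain ⟨j, hj, hjJ, hind⟩ := exists_linearIndepOn_insert hJ (T := (I : Set ι))
    (by rw [finrank_span_image_of_linearIndepOn hI.1]; omega)
  have h := hI.2 _ hind (by rw [Finset.card_insert_of_notMem hjJ, hc, hc'])
  rw [Finset.sum_insert hjJ, ← Finset.add_sum_erase I w hi] at h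
  have := hmax j hj
  omega

/-- If minimal sets for `w` have the same weight with respect to `w'`, then the weights agree on
minimal sets. -/
lemma eq_on (h : ∀ J, IsMinWeight K v w J → J.card ≤ I.card → ∑ i ∈ J, w i = ∑ i ∈ J, w' i)
    (hI : IsMinWeight K v w I) : ∀ i ∈ I, w i = w' i := by
  induction hk : I.card generalizing I with
  | zero => simp [Finset.card_eq_zero.mp hk]
  | succ k ih =>
    obtain ⟨i, hi, hmax⟩ := I.exists_max_image w (Finset.card_pos.mp (by omega))
    have hc := Finset.card_erase_add_one hi
    have hrest := ih (fun J hJ hle => h J hJ (by omega)) (hI.erase hi hmax) (by omega)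
    have hsum := h I hI le_rfl
    rw [← Finset.add_sum_erase I w hi, ← Finset.add_sum_erase I w' hi,
      Finset.sum_congr rfl hrest] at hsum
    intro j hj
    by_cases hji : j = i
    · subst hji; linarith
    · exact hrest j (Finset.mem_erase.mpr ⟨hji, hj⟩)

/-- If the increment of minimal weights is at most `s`, the vectors of weight at most `s` span a
space of the corresponding dimension. -/
lemma card_le_finrank [Finite ι] (hI : IsMinWeight K v w I) (hJ : IsMinWeight K v w J)
    (hc : I.card = J.card + 1) {s : ℤ} (hs : ∑ i ∈ I, w i - ∑ i ∈ J, w i ≤ s) :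
    I.card ≤ Module.finrank K (Submodule.span K (v '' {i | w i ≤ s})) := by
  by_cases hall : ∀ i ∈ I, w i ≤ s
  · have : FiniteDimensional K (Submodule.span K (v '' {i | w i ≤ s})) :=
      FiniteDimensional.span_of_finite K (Set.toFinite _)
    rw [← finrank_span_image_of_linearIndepOn hI.1]
    exact Submodule.finrank_mono (Submodule.span_mono (Set.image_mono hall))
  · push Not at hall
    obtain ⟨i, hi, hlt⟩ := hall
    have hc' := Finset.card_erase_add_one hi
    -- Erasing `i` leaves weight at least that of `J`, so the increment is at least `w i > s`.
    have h := hJ.2 _ (LinearIndepOn.erase hI.1 i) (by omega)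
    rw [← Finset.add_sum_erase I w hi] at hs
    omega

/-- If the increment of minimal weights is more than `s`, the vectors of weight at most `s` span a
space of smaller dimension. -/
lemma finrank_le_card (hI : IsMinWeight K v w I) (hJ : IsMinWeight K v w J)
    (hc : I.card = J.card + 1) {s : ℤ} (hs : s < ∑ i ∈ I, w i - ∑ i ∈ J, w i) :
    Module.finrank K (Submodule.span K (v '' {i | w i ≤ s})) ≤ J.card := by
  by_contra! hlt
  obtain ⟨j, hj, hjJ, hind⟩ := exists_linearIndepOn_insert hJ.1 hlt
  have h := hI.2 _ hind (by rw [Finset.card_insert_of_notMem hjJ, hc])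
  rw [Finset.sum_insert hjJ] at h
  have : w j ≤ s := hj
  omega

end IsMinWeight

end MinWeight

/-! ### Extension of scalars from the lattice. -/

section Lattice

variable {M : Type*} [AddCommGroup M]

@[simp] lemma toNReal_toMReal (ν : NLat M) (m : M) : toNReal ν (toMReal m) = (ν m : ℝ) := by
  simp [toNReal, toMReal]

@[simp] lemma toNRat_toMRat (ν : NLat M) (m : M) : toNRat ν (toMRat m) = (ν m : ℚ) := by
  simp [toNRat, toMRat]

lemma toMReal_ne_zero [Module.Free ℤ M] {m : M} (hm : m ≠ 0) : toMReal m ≠ 0 := fun h =>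
  hm (Module.Flat.tensorProduct_mk_injective (R := ℤ) (S := ℝ) M
    (h.trans (TensorProduct.tmul_zero M (1 : ℝ)).symm))

lemma linearIndependent_toMRat_iff [Module.Free ℤ M] {ι : Type*} {v : ι → M} :
    LinearIndependent ℚ (fun i => toMRat (v i)) ↔ LinearIndependent ℤ v := by
  refine ⟨fun h => ?_, fun h => Module.Flat.linearIndependent_one_tmul h⟩
  have h' : LinearIndependent ℤ (fun i => toMRat (v i)) :=
    h.restrict_scalars' ℤ
  exact LinearIndependent.of_comp (TensorProduct.mk ℤ ℚ M 1) h'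

end Lattice

/-! ### Newton polyhedra and the spaces `ℓ_ν^s`. -/

section Semigroup

variable {M : Type*} [AddCommGroup M] {Λ : AddSubmonoid M}

lemma toMReal_mem_dualCone {u : M} (hu : u ∈ Λ) : toMReal u ∈ dualCone Λ :=
  Submodule.subset_span ⟨u, hu, rfl⟩

lemma mem_sigma_of_mem_sigmaInterior {x : NReal M} (hx : x ∈ sigmaInterior Λ) : x ∈ sigma Λ := by
  let _ : TopologicalSpace (NReal M) := moduleTopology ℝ (NReal M)
  exact (interior_subset : interior (sigma Λ) ⊆ sigma Λ) hx

/-- If `f w ≠ 0`, then `x - c (f w) f` stays in `σ` for small `c > 0`, so `x w ≥ c (f w)² > 0`. -/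
lemma pos_of_mem_sigmaInterior {x : NReal M} (hx : x ∈ sigmaInterior Λ) {w : MReal M}
    (hw : w ∈ dualCone Λ) (hw0 : w ≠ 0) : 0 < x w := by
  let _ : TopologicalSpace (NReal M) := moduleTopology ℝ (NReal M)
  have : IsModuleTopology ℝ (NReal M) := ⟨rfl⟩
  have : ContinuousAdd (NReal M) := IsModuleTopology.toContinuousAdd ℝ _
  have : ContinuousSMul ℝ (NReal M) := IsModuleTopology.toContinuousSMul ℝ _
  obtain ⟨f, hf⟩ : ∃ f : NReal M, f w ≠ 0 := by
    by_contra! h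
    exact hw0 ((Module.forall_dual_apply_eq_zero_iff ℝ w).mp h)
  have hcont : Continuous fun c : ℝ => x + (-c * f w) • f := by fun_prop
  have hnhds : ∀ᶠ c in nhds (0 : ℝ), x + (-c * f w) • f ∈ sigma Λ := by
    refine hcont.continuousAt.eventually_mem (mem_interior_iff_mem_nhds.mp ?_)
    simp only [neg_zero, zero_mul, zero_smul, add_zero]
    exact hx
  obtain ⟨ε, hε, hball⟩ := Metric.eventually_nhds_iff.mp hnhds
  have h := @hball (ε / 2) (by simp [abs_of_pos hε, hε]) w hw
  simp only [LinearMap.add_apply, LinearMap.smul_apply, smul_eq_mul] at h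
  have : 0 < ε / 2 * (f w * f w) := mul_pos (half_pos hε) (mul_self_pos.mpr hf)
  nlinarith

lemma mem_newtonPolyhedron {I : Set M} {m : M} (hm : m ∈ I) :
    toMReal m ∈ newtonPolyhedron Λ I :=
  subset_convexHull ℝ _ ⟨m, hm, 0, zero_mem _, by simp⟩

lemma le_of_mem_newtonPolyhedron {I : Set M} {x : NReal M} (hx : x ∈ sigma Λ) {c : ℝ}
    (hc : ∀ m ∈ I, c ≤ x (toMReal m)) {w : MReal M} (hw : w ∈ newtonPolyhedron Λ I) : c ≤ x w := by
  refine convexHull_min (t := {w | c ≤ x w}) ?_ (convex_halfSpace_ge x.isLinear c) hw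
  rintro _ ⟨m, hm, u, hu, rfl⟩
  have h1 := hc m hm
  have h2 := hx u hu
  simp only [Set.mem_ofPred_eq, map_add]
  linarith

lemma ordIdeal_eq {I : Set M} {x : NReal M} (hx : x ∈ sigma Λ) {m : M} (hm : m ∈ I)
    (hmin : ∀ m' ∈ I, x (toMReal m) ≤ x (toMReal m')) : ordIdeal Λ I x = x (toMReal m) := by
  refine IsLeast.csInf_eq ⟨⟨_, mem_newtonPolyhedron hm, rfl⟩, ?_⟩
  rintro _ ⟨w, hw, rfl⟩
  exact le_of_mem_newtonPolyhedron hx hmin hw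

/-- If every element of `I` on which `x` takes its minimum `c` also has value `c` under `y`, then
so does every point of the face of the Newton polyhedron defined by `x`. -/
lemma eq_of_mem_newtonFace {I : Set M} {x y : NReal M} (hx : x ∈ sigmaInterior Λ) {c : ℝ}
    (hc : ∀ m ∈ I, c < x (toMReal m) ∨ x (toMReal m) = c ∧ y (toMReal m) = c) {w : MReal M}
    (hw : w ∈ newtonPolyhedron Λ I) (hxw : x w = c) : y w = c := by
  suffices h : c < x w ∨ x w = c ∧ y w = c by
    rcases h with h | h
    · exact absurd hxw h.ne'
    · exact h.2
  refine convexHull_min (t := {w | c < x w ∨ x w = c ∧ y w = c}) ?_ ?_ hw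
  · rintro _ ⟨m, hm, u, hu, rfl⟩
    by_cases hu0 : u = 0
    · simpa [hu0] using hc m hm
    · have h1 := pos_of_mem_sigmaInterior hx hu hu0
      left
      rw [map_add]
      rcases hc m hm with h | h <;> linarith
  · intro p hp q hq a b ha hb hab
    simp only [Set.mem_ofPred_eq, map_add, map_smul, smul_eq_mul] at hp hq ⊢
    rcases ha.eq_or_lt with rfl | ha'
    · obtain rfl : b = 1 := by linarith
      simpa using hq
    rcases hb.eq_or_lt with rfl | hb'
    · obtain rfl : a = 1 := by linarith
      simpa using hp
    have hc' : c = a * c + b * c := by rw [← add_mul, hab, one_mul]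
    rcases hp with hp | ⟨hp, hp'⟩ <;> rcases hq with hq | ⟨hq, hq'⟩
    · left; rw [hc']; gcongr
    · left; rw [hc', hq]; gcongr
    · left; rw [hc', hp]; gcongr
    · right; rw [hp, hq, hp', hq']; exact ⟨hc'.symm, hc'.symm⟩

variable {n : ℕ} {e : Fin n → M}

/-- Passing to `ℚ`-independence makes the exchange arguments over a field available. -/
lemma mem_logJac_iff [Module.Free ℤ M] {k : ℕ} {m : M} : m ∈ logJac e k ↔ ∃ I : Finset (Fin n), I.card = k ∧
    LinearIndepOn ℚ (fun i => toMRat (e i)) (I : Set (Fin n)) ∧ m = ∑ i ∈ I, e i := by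
  refine exists_congr fun I => and_congr_right fun _ => and_congr_left fun _ => ?_
  exact linearIndependent_toMRat_iff.symm

variable (e) in
/-- `I` is a minimal-weight independent subfamily of the `e_i` with weights `⟨ν, e_i⟩`. -/
abbrev IsNuMin (ν : NLat M) (I : Finset (Fin n)) : Prop :=
  IsMinWeight ℚ (fun i => toMRat (e i)) (fun i => ν (e i)) I

lemma ordJ_eq [Module.Free ℤ M] {ν : NLat M} (hν : toNReal ν ∈ sigma Λ) {I : Finset (Fin n)} (hI : IsNuMin e ν I) :
    ordJ Λ e I.card (toNReal ν) = ((∑ i ∈ I, ν (e i) : ℤ) : ℝ) := by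
  rw [ordJ, ordIdeal_eq hν (mem_logJac_iff.mpr ⟨I, rfl, hI.1, rfl⟩), toNReal_toMReal, map_sum]
  intro m hm
  obtain ⟨J, hc, hJ, rfl⟩ := mem_logJac_iff.mp hm
  simp only [toNReal_toMReal, map_sum]
  exact_mod_cast hI.2 J hJ hc

lemma ell_eq (ν : NLat M) (s : ℕ) :
    ell e ν s = Submodule.span ℚ ((fun i => toMRat (e i)) '' {i | ν (e i) ≤ (s : ℤ)}) := by
  rw [ell]
  congr 1
  ext x
  exact exists_congr fun i => and_congr_right fun _ => eq_comm

lemma span_toMRat_eq_top (hΛ : IsToricSemigroup Λ) (he : AddSubmonoid.closure (Set.range e) = Λ) :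
    Submodule.span ℚ ((fun i => toMRat (e i)) '' Set.univ) = ⊤ := by
  have hle : ∀ m : M, toMRat m ∈ Submodule.span ℚ ((fun i => toMRat (e i)) '' Set.univ) := by
    have h1 : ∀ u ∈ Λ, toMRat u ∈ Submodule.span ℚ ((fun i => toMRat (e i)) '' Set.univ) := by
      intro u hu
      rw [← he] at hu
      induction hu using AddSubmonoid.closure_induction with
      | mem x hx => obtain ⟨i, rfl⟩ := hx; exact Submodule.subset_span ⟨i, trivial, rfl⟩
      | zero => simp [toMRat]
      | add x y _ _ hx hy =>
        simpa only [toMRat, TensorProduct.tmul_add] using add_mem hx hy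
    intro m
    have hm : m ∈ AddSubgroup.closure (Λ : Set M) := hΛ.generates ▸ AddSubgroup.mem_top m
    induction hm using AddSubgroup.closure_induction with
    | mem x hx => exact h1 x hx
    | zero => simp [toMRat]
    | add x y _ _ hx hy => simpa only [toMRat, TensorProduct.tmul_add] using add_mem hx hy
    | neg x _ hx => simpa only [toMRat, TensorProduct.tmul_neg, neg_mem_iff] using hx
  rw [eq_top_iff]
  rintro x -
  induction x using TensorProduct.induction_on with
  | zero => exact zero_mem _
  | tmul q m =>
    have : q ⊗ₜ[ℤ] m = q • toMRat m := by simp [toMRat, TensorProduct.smul_tmul']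
    rw [this]
    exact Submodule.smul_mem _ _ (hle m)
  | add x y hx hy => exact add_mem hx hy

lemma exists_isNuMin [Module.Free ℤ M] (hΛ : IsToricSemigroup Λ)
    (he : AddSubmonoid.closure (Set.range e) = Λ)
    (ν : NLat M) {k : ℕ} (hk : k ≤ Module.finrank ℤ M) :
    ∃ I : Finset (Fin n), I.card = k ∧ IsNuMin e ν I := by
  refine exists_isMinWeight _ (exists_linearIndepOn_card (T := Set.univ) ?_)
  rw [span_toMRat_eq_top hΛ he, finrank_top, Module.finrank_baseChange]
  exact hk

lemma phi_eq [Module.Free ℤ M] {ν : NLat M} (hν : toNReal ν ∈ sigma Λ) {I J : Finset (Fin n)}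
    (hI : IsNuMin e ν I) (hJ : IsNuMin e ν J) (hc : I.card = J.card + 1)
    (hle : I.card ≤ Module.finrank ℤ M) :
    phi Λ e I.card (toNReal ν) =
      (((∑ i ∈ I, ν (e i) - ∑ i ∈ J, ν (e i) : ℤ) : ℝ) : EReal) := by
  rw [phi, if_neg (by omega), if_neg (by omega)]
  split_ifs with h1
  · have : J = ∅ := Finset.card_eq_zero.mp (by omega)
    subst this
    rw [← h1, ordJ_eq hν hI]
    simp
  · rw [ordJ_eq hν hI, hc, Nat.add_sub_cancel, ordJ_eq hν hJ]
    push_cast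
    rfl

/-- The bound `φ_k ≤ s` gives dimension at least `k`, and `s < φ_{k+1}` gives at most `k`. When `k`
is the rank, the upper bound is the dimension of the whole space. -/
lemma finrank_ell_eq [Module.Free ℤ M] [Module.Finite ℤ M] (hΛ : IsToricSemigroup Λ) (he : AddSubmonoid.closure (Set.range e) = Λ)
    {k : ℕ} (hk : k ≤ Module.finrank ℤ M) {ν : NLat M} {s : ℕ} (h : (ν, s) ∈ A Λ e k) :
    Module.finrank ℚ (ell e ν s) = k := by
  obtain ⟨hint, hlo, hhi⟩ := h
  have hν := mem_sigma_of_mem_sigmaInterior hint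
  obtain ⟨I, rfl, hI⟩ := exists_isNuMin hΛ he ν hk
  simp only at hlo hhi
  rw [ell_eq]
  apply le_antisymm
  · rcases hk.eq_or_lt with hk | hk
    · rw [hk, ← Module.finrank_baseChange (R := ℚ) (S := ℤ) (M' := M)]
      exact Submodule.finrank_le _
    · obtain ⟨J, hJc, hJ⟩ := exists_isNuMin hΛ he ν (k := I.card + 1) hk
      rw [← hJc, phi_eq hν hJ hI hJc (by omega)] at hhi
      exact hJ.finrank_le_card hI hJc (by exact_mod_cast hhi)
  · rcases I.card.eq_zero_or_pos with h0 | hpos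
    · omega
    · obtain ⟨J, hJc, hJ⟩ := exists_isNuMin hΛ he ν (k := I.card - 1) (by omega)
      have hc : I.card = J.card + 1 := by omega
      rw [phi_eq hν hI hJ hc hk] at hlo
      exact hI.card_le_finrank hJ hc (by exact_mod_cast hlo)

lemma ell_agree_of_equivalent [Module.Free ℤ M] [Module.Finite ℤ M] (hΛ : IsToricSemigroup Λ)
    (he : AddSubmonoid.closure (Set.range e) = Λ) {k : ℕ} (hk : k ≤ Module.finrank ℤ M)
    {ν ν' : NLat M} {s : ℕ} (h : (ν, s) ∈ A Λ e k) (h' : (ν', s) ∈ A Λ e k)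
    (hE : Equivalent Λ e k (ν, s) (ν', s)) :
    ell e ν s = ell e ν' s ∧ ∀ x ∈ ell e ν s, toNRat ν x = toNRat ν' x := by
  have hr := finrank_ell_eq hΛ he hk h
  have hr' := finrank_ell_eq hΛ he hk h'
  have hν := mem_sigma_of_mem_sigmaInterior h.1
  obtain ⟨I, rfl, hI⟩ := exists_isNuMin hΛ he ν hk
  have hagree : ∀ i ∈ I, ν (e i) = ν' (e i) := by
    refine hI.eq_on fun J hJ hle => ?_
    rcases J.card.eq_zero_or_pos with h0 | hpos
    · simp [Finset.card_eq_zero.mp h0]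
    · obtain ⟨hface, hord⟩ := hE.2 J.card hpos hle
      -- A `ν`-minimal sum lies on the face of `ν`, hence on that of `ν'`; equal orders then give it
      -- equal values.
      have hmem : toMReal (∑ i ∈ J, e i) ∈ newtonFace Λ (logJac e J.card) (toNReal ν) := by
        refine ⟨mem_newtonPolyhedron (mem_logJac_iff.mpr ⟨J, rfl, hJ.1, rfl⟩), ?_⟩
        rw [toNReal_toMReal, map_sum]
        exact (ordJ_eq hν hJ).symm
      have h1 := hmem.2
      have h2 := (hface ▸ hmem).2
      rw [← ordJ, hord] at h1
      rw [← ordJ, ← h1, toNReal_toMReal, toNReal_toMReal, map_sum, map_sum] at h2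
      exact_mod_cast h2.symm
  have hle : ∀ i ∈ I, ν (e i) ≤ s := fun i hi => hI.le_of_mem (by rw [← ell_eq, hr]) hi
  -- The same `I` spans both `ℓ_ν^s` and `ℓ_ν'^s`, by dimension.
  have hspan : ∀ {μ : NLat M}, (∀ i ∈ I, μ (e i) ≤ s) → Module.finrank ℚ (ell e μ s) = I.card →
      Submodule.span ℚ ((fun i => toMRat (e i)) '' I) = ell e μ s := by
    intro μ hμ hμr
    refine Submodule.eq_of_le_of_finrank_eq ?_ ?_
    · rw [ell_eq]
      exact Submodule.span_mono (Set.image_mono hμ)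
    · rw [hμr, finrank_span_image_of_linearIndepOn hI.1]
  have h1 := hspan hle hr
  have h2 := hspan (fun i hi => hagree i hi ▸ hle i hi) hr'
  refine ⟨h1.symm.trans h2, ?_⟩
  rw [← h1]
  intro x hx
  refine LinearMap.eqOn_span' (f := toNRat ν) (g := toNRat ν') ?_ hx
  rintro _ ⟨i, hi, rfl⟩
  simp [hagree i hi]

/-- Two forms agree on the `e_i` on which either takes a value at most `s`. -/
def AgreeUpTo (e : Fin n → M) (s : ℕ) (ν ν' : NLat M) : Prop :=
  ∀ i, (ν (e i) ≤ s ∨ ν' (e i) ≤ s) → ν (e i) = ν' (e i)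

lemma AgreeUpTo.symm {s : ℕ} {ν ν' : NLat M} (h : AgreeUpTo e s ν ν') : AgreeUpTo e s ν' ν :=
  fun i hi => (h i hi.symm).symm

lemma agreeUpTo_iff {s : ℕ} {ν ν' : NLat M} : AgreeUpTo e s ν ν' ↔
    ell e ν s = ell e ν' s ∧ ∀ x ∈ ell e ν s, toNRat ν x = toNRat ν' x := by
  have hmem : ∀ (μ : NLat M) i, μ (e i) ≤ s → toMRat (e i) ∈ ell e μ s := fun μ i hi =>
    Submodule.subset_span ⟨i, hi, rfl⟩
  constructor
  · intro h
    constructor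
    · rw [ell, ell]
      congr 1
      ext x
      refine exists_congr fun i => and_congr_left fun _ => ⟨fun hi => ?_, fun hi => ?_⟩
      · exact h i (.inl hi) ▸ hi
      · exact h i (.inr hi) ▸ hi
    · intro x hx
      refine LinearMap.eqOn_span' (f := toNRat ν) (g := toNRat ν') ?_ hx
      rintro _ ⟨i, hi, rfl⟩
      simp [h i (.inl hi)]
  · rintro ⟨hell, hag⟩ i hi
    have : toMRat (e i) ∈ ell e ν s := by
      rcases hi with hi | hi
      · exact hmem ν i hi
      · exact hell ▸ hmem ν' i hi
    simpa using hag _ this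

lemma AgreeUpTo.isNuMin {s : ℕ} {ν ν' : NLat M} (h : AgreeUpTo e s ν ν') {I : Finset (Fin n)}
    (hI : IsNuMin e ν I) (hc : I.card ≤ Module.finrank ℚ (ell e ν s)) :
    IsNuMin e ν' I ∧ ∀ i ∈ I, ν (e i) = ν' (e i) := by
  have hag : ∀ i ∈ I, ν (e i) = ν' (e i) := fun i hi =>
    h i (.inl (hI.le_of_mem (by rwa [← ell_eq]) hi))
  refine ⟨?_, hag⟩
  -- A `ν'`-minimal `J` of the same size also involves only weights at most `s`, so the `ν'`-weights
  -- of `I` and `J` can be compared through `ν`.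
  obtain ⟨J, hJc, hJ⟩ := exists_isMinWeight (fun i => ν' (e i)) ⟨I, rfl, hI.1⟩
  have hagJ : ∀ i ∈ J, ν (e i) = ν' (e i) := fun i hi =>
    h i (.inr (hJ.le_of_mem (by rw [← ell_eq, ← (agreeUpTo_iff.mp h).1, hJc]; exact hc) hi))
  refine ⟨hI.1, fun L hL hLc => ?_⟩
  have h1 := hJ.2 L hL (by omega)
  have h2 := hI.2 J hJ.1 hJc
  rw [Finset.sum_congr rfl hag, Finset.sum_congr rfl hagJ] at h2
  exact h2.trans h1

/-- Each generating sum on the face of `ν` comes from a `ν`-minimal set, where the forms agree; the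
other sums lie strictly above the minimum. -/
lemma AgreeUpTo.newtonFace_subset [Module.Free ℤ M] {s : ℕ} {ν ν' : NLat M} (h : AgreeUpTo e s ν ν')
    (hν : toNReal ν ∈ sigmaInterior Λ) {I : Finset (Fin n)}
    (hI : IsNuMin e ν I) (hc : I.card ≤ Module.finrank ℚ (ell e ν s))
    (hord : ordJ Λ e I.card (toNReal ν) = ordJ Λ e I.card (toNReal ν')) :
    newtonFace Λ (logJac e I.card) (toNReal ν) ⊆ newtonFace Λ (logJac e I.card) (toNReal ν') := by
  rintro w ⟨hw, hval⟩
  refine ⟨hw, ?_⟩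
  rw [← ordJ, ordJ_eq (mem_sigma_of_mem_sigmaInterior hν) hI] at hval
  rw [← ordJ, ← hord, ordJ_eq (mem_sigma_of_mem_sigmaInterior hν) hI]
  refine eq_of_mem_newtonFace hν (fun m hm => ?_) hw hval
  obtain ⟨J, hJc, hJ, rfl⟩ := mem_logJac_iff.mp hm
  simp only [toNReal_toMReal, map_sum]
  rcases (hI.2 J hJ hJc).lt_or_eq with hlt | heq
  · left; exact_mod_cast hlt
  · right
    have hJmin : IsNuMin e ν J := ⟨hJ, fun L hL hLc => heq ▸ hI.2 L hL (hLc.trans hJc)⟩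
    have hag := (h.isNuMin hJmin (hJc ▸ hc)).2
    have := Finset.sum_congr rfl hag
    exact ⟨by exact_mod_cast heq.symm, by exact_mod_cast this.symm.trans heq.symm⟩

lemma AgreeUpTo.equivalent [Module.Free ℤ M] [Module.Finite ℤ M] (hΛ : IsToricSemigroup Λ)
    (he : AddSubmonoid.closure (Set.range e) = Λ) {k : ℕ} (hk : k ≤ Module.finrank ℤ M)
    {ν ν' : NLat M} {s : ℕ} (hA : (ν, s) ∈ A Λ e k) (hA' : (ν', s) ∈ A Λ e k)
    (h : AgreeUpTo e s ν ν') : Equivalent Λ e k (ν, s) (ν', s) := by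
  refine ⟨rfl, fun j _ hj => ?_⟩
  obtain ⟨I, rfl, hI⟩ := exists_isNuMin hΛ he ν (hj.trans hk)
  have hc : I.card ≤ Module.finrank ℚ (ell e ν s) := by rwa [finrank_ell_eq hΛ he hk hA]
  have hc' : I.card ≤ Module.finrank ℚ (ell e ν' s) := by rwa [finrank_ell_eq hΛ he hk hA']
  obtain ⟨hI', hag⟩ := h.isNuMin hI hc
  have hord : ordJ Λ e I.card (toNReal ν) = ordJ Λ e I.card (toNReal ν') := by
    rw [ordJ_eq (mem_sigma_of_mem_sigmaInterior hA.1) hI,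
      ordJ_eq (mem_sigma_of_mem_sigmaInterior hA'.1) hI', Finset.sum_congr rfl hag]
  exact ⟨(h.newtonFace_subset hA.1 hI hc hord).antisymm
    (h.symm.newtonFace_subset hA'.1 hI' hc' hord.symm), hord⟩

end Semigroup

/-! ### Arcs, their orders and their jets. -/

section Arcs

variable {M : Type*} [AddCommGroup M] {Λ : AddSubmonoid M}

lemma exists_ofPowerSeries_eq {x : LaurentSeries ℂ} (hx : 0 ≤ x.order) :
    ∃ p : PowerSeries ℂ, HahnSeries.ofPowerSeries ℤ ℂ p = x := by
  refine ⟨PowerSeries.mk fun k => x.coeff k, ?_⟩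
  ext a
  rcases lt_or_ge a 0 with ha | ha
  · rw [HahnSeries.coeff_eq_zero_of_lt_order (ha.trans_le hx), HahnSeries.ofPowerSeries_apply,
      HahnSeries.embDomain_of_notMem_range]
    rintro ⟨k, rfl⟩
    simp at ha
    omega
  · lift a to ℕ using ha
    rw [HahnSeries.ofPowerSeries_apply_coeff, PowerSeries.coeff_mk]

lemma generic_ne_zero (g : AddMonoidAlgebra ℂ M →ₐ[ℂ] LaurentSeries ℂ) (m : M) :
    g (AddMonoidAlgebra.single m 1) ≠ 0 := by
  intro h
  have : g (AddMonoidAlgebra.single m 1 * AddMonoidAlgebra.single (-m) 1) = 0 := by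
    rw [map_mul, h, zero_mul]
  rw [AddMonoidAlgebra.single_mul_single, add_neg_cancel, one_mul, ← AddMonoidAlgebra.one_def,
    map_one] at this
  exact one_ne_zero this

/-- A morphism from the punctured formal disc to the torus with positive orders on `Λ \ {0}`
extends to an arc. -/
lemma exists_arc (g : AddMonoidAlgebra ℂ M →ₐ[ℂ] LaurentSeries ℂ) {ν : NLat M}
    (hg : ∀ m, (g (AddMonoidAlgebra.single m 1)).order = ν m)
    (hν : ∀ u ∈ Λ, u ≠ 0 → 0 < ν u) : ∃ h ∈ HStarOrbit Λ ν, IsGenericPart h g := by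
  have hnonneg : ∀ u : Λ, 0 ≤ (g (AddMonoidAlgebra.single (u : M) 1)).order := by
    intro u
    rw [hg]
    by_cases hu : (u : M) = 0
    · simp [hu]
    · exact (hν u u.2 hu).le
  choose p hp using fun u : Λ => exists_ofPowerSeries_eq (hnonneg u)
  have hinj := HahnSeries.ofPowerSeries_injective (Γ := ℤ) (R := ℂ)
  let F : Multiplicative Λ →* PowerSeries ℂ :=
    { toFun := fun u => p u.toAdd
      map_one' := hinj (((hp 0).trans (map_one g)).trans (map_one _).symm)
      map_mul' := fun a b => hinj (by
        rw [toAdd_mul, map_mul, hp, hp, hp, ← map_mul, AddMonoidAlgebra.single_mul_single,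
          AddSubmonoid.coe_add, one_mul]) }
  let h : Arc Λ := AddMonoidAlgebra.lift ℂ (PowerSeries ℂ) Λ F
  have hpull : ∀ u, pull h u = p u := fun u => by simp [pull, h, F]
  have hgen : IsGenericPart h g := fun u => by rw [hpull, hp]
  refine ⟨h, ⟨⟨fun u hu => ?_, g, hgen⟩, g, hgen, hg⟩, hgen⟩
  rw [hpull, ← PowerSeries.coeff_zero_eq_constantCoeff_apply,
    ← HahnSeries.ofPowerSeries_apply_coeff (Γ := ℤ), hp]
  refine HahnSeries.coeff_eq_zero_of_lt_order ?_
  rw [hg]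
  exact hν u u.2 (by simpa using hu)

variable (ν : NLat M) in
/-- The one-parameter subgroup `X^m ↦ t^⟨ν, m⟩`. -/
def oneParam : Multiplicative M →* LaurentSeries ℂ where
  toFun m := HahnSeries.single (ν m.toAdd) 1
  map_one' := by simp
  map_mul' a b := by simp

/-- Translation by a one-parameter subgroup: `G = 1` yields an arc of prescribed orders, while the
generic part of an arc has its orders shifted by `μ`. -/
lemma exists_generic_mul (G : Multiplicative M →* LaurentSeries ℂ) (μ : NLat M) :
    ∃ g : AddMonoidAlgebra ℂ M →ₐ[ℂ] LaurentSeries ℂ, ∀ m : M,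
      g (AddMonoidAlgebra.single m 1) = HahnSeries.single (μ m) 1 * G (.ofAdd m) :=
  ⟨AddMonoidAlgebra.lift ℂ _ M (oneParam μ * G), fun m => by
    rw [AddMonoidAlgebra.lift_single, Algebra.smul_def, map_one, one_mul]
    rfl⟩

lemma pos_of_toNReal_mem_sigmaInterior [Module.Free ℤ M] {ν : NLat M}
    (hν : toNReal ν ∈ sigmaInterior Λ) {u : M} (hu : u ∈ Λ) (hu0 : u ≠ 0) : 0 < ν u := by
  have h := pos_of_mem_sigmaInterior hν (toMReal_mem_dualCone hu) (toMReal_ne_zero hu0)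
  rw [toNReal_toMReal] at h
  exact_mod_cast h

lemma jetOrbit_nonempty {ν : NLat M} (hν : ∀ u ∈ Λ, u ≠ 0 → 0 < ν u) (s : ℕ) :
    (jetOrbit Λ s ν).Nonempty := by
  obtain ⟨g, hg⟩ := exists_generic_mul (M := M) 1 ν
  obtain ⟨h, hh, -⟩ := exists_arc g (ν := ν) (fun m => by simp [hg]) hν
  exact ⟨_, h, hh, rfl⟩

lemma X_pow_dvd_pull {h : Arc Λ} {ν : NLat M} (hh : h ∈ HStarOrbit Λ ν) {s : ℕ} {u : Λ}
    (hu : (s : ℤ) < ν u) : (PowerSeries.X : PowerSeries ℂ) ^ (s + 1) ∣ pull h u := by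
  obtain ⟨-, g, hgen, hg⟩ := hh
  refine PowerSeries.X_pow_dvd_iff.mpr fun a ha => ?_
  rw [← HahnSeries.ofPowerSeries_apply_coeff (Γ := ℤ), ← hgen u]
  refine HahnSeries.coeff_eq_zero_of_lt_order ?_
  rw [hg]
  omega

lemma jet_single_eq_iff {h h' : Arc Λ} {s : ℕ} {u : Λ} :
    jet s h (AddMonoidAlgebra.single u 1) = jet s h' (AddMonoidAlgebra.single u 1) ↔
      (PowerSeries.X : PowerSeries ℂ) ^ (s + 1) ∣ pull h u - pull h' u := by
  rw [← Ideal.mem_span_singleton, ← Ideal.Quotient.eq]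
  rfl

lemma jet_eq_of_generators {n : ℕ} {e : Fin n → M}
    (he : AddSubmonoid.closure (Set.range e) = Λ) {s : ℕ} {h h' : Arc Λ}
    (hgen : ∀ (i : Fin n) (hi : e i ∈ Λ), jet s h (AddMonoidAlgebra.single ⟨e i, hi⟩ 1) =
      jet s h' (AddMonoidAlgebra.single ⟨e i, hi⟩ 1)) : jet s h = jet s h' := by
  subst he
  have hall : ∀ (u : M) (hu : u ∈ AddSubmonoid.closure (Set.range e)),
      jet s h (AddMonoidAlgebra.single ⟨u, hu⟩ 1) =
        jet s h' (AddMonoidAlgebra.single ⟨u, hu⟩ 1) := by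
    intro u hu
    induction hu using AddSubmonoid.closure_induction with
    | mem x hx => obtain ⟨i, rfl⟩ := hx; exact hgen i _
    | zero =>
      exact (map_one (jet s h)).trans (map_one (jet s h')).symm
    | add x y hx hy ihx ihy =>
      have : AddMonoidAlgebra.single (⟨x + y, add_mem hx hy⟩ :
          AddSubmonoid.closure (Set.range e)) (1 : ℂ) =
          AddMonoidAlgebra.single ⟨x, hx⟩ 1 * AddMonoidAlgebra.single ⟨y, hy⟩ 1 := by
        rw [AddMonoidAlgebra.single_mul_single, one_mul]
        rfl
      rw [this, map_mul, map_mul, ihx, ihy]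
  refine AddMonoidAlgebra.algHom_ext' (MonoidHom.ext fun u => ?_) (Subsingleton.elim _ _)
  exact hall u.toAdd u.toAdd.2

variable {n : ℕ} {e : Fin n → M}

lemma AgreeUpTo.jetOrbit_subset (he : AddSubmonoid.closure (Set.range e) = Λ) {s : ℕ}
    {ν ν' : NLat M} (hag : AgreeUpTo e s ν ν') (hν' : ∀ u ∈ Λ, u ≠ 0 → 0 < ν' u) :
    jetOrbit Λ s ν ⊆ jetOrbit Λ s ν' := by
  rintro _ ⟨h, hh, rfl⟩
  obtain ⟨-, g, hgen, hg⟩ := id hh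
  obtain ⟨g', hg'⟩ := exists_generic_mul
    ((g : AddMonoidAlgebra ℂ M →* LaurentSeries ℂ).comp (AddMonoidAlgebra.of ℂ M)) (ν' - ν)
  have hg'2 : ∀ m, g' (AddMonoidAlgebra.single m 1) =
      HahnSeries.single (ν' m - ν m) 1 * g (AddMonoidAlgebra.single m 1) := hg'
  obtain ⟨h', hh', hgen'⟩ := exists_arc g' (ν := ν') (fun m => by
    rw [hg'2, HahnSeries.order_mul (by simp) (generic_ne_zero g m),
      HahnSeries.order_single one_ne_zero, hg, sub_add_cancel]) hν'
  refine ⟨h', hh', jet_eq_of_generators he fun i hi => jet_single_eq_iff.mpr ?_⟩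
  -- Either the translation factor is `t^0` on this coordinate, or both series are divisible by
  -- `t^(s+1)`.
  by_cases hs : ν (e i) ≤ s ∨ ν' (e i) ≤ s
  · have : pull h' ⟨e i, hi⟩ = pull h ⟨e i, hi⟩ := by
      apply HahnSeries.ofPowerSeries_injective (Γ := ℤ)
      rw [← hgen, ← hgen', hg'2]
      simp [hag i hs]
    rw [this, sub_self]
    exact dvd_zero _
  · push Not at hs
    exact dvd_sub (X_pow_dvd_pull hh' hs.2) (X_pow_dvd_pull hh hs.1)

/-- The leading term of `X^u ∘ h` has degree at most `s`, so it survives in the jet and must also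
occur in `X^u ∘ h'`. -/
lemma order_le_of_jet_eq {ν ν' : NLat M} {h h' : Arc Λ} (hh : h ∈ HStarOrbit Λ ν)
    (hh' : h' ∈ HStarOrbit Λ ν') {s : ℕ} (hj : jet s h = jet s h') {u : Λ} (hu0 : 0 ≤ ν u)
    (hu : ν u ≤ s) : ν' u ≤ ν u := by
  by_contra! hlt
  obtain ⟨-, g, hgen, hg⟩ := hh
  obtain ⟨-, g', hgen', hg'⟩ := hh'
  have hdvd := jet_single_eq_iff.mp (DFunLike.congr_fun hj (AddMonoidAlgebra.single u 1))
  have hc := PowerSeries.X_pow_dvd_iff.mp hdvd (ν u).toNat (by omega)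
  rw [map_sub, sub_eq_zero, ← HahnSeries.ofPowerSeries_apply_coeff (Γ := ℤ),
    ← HahnSeries.ofPowerSeries_apply_coeff (Γ := ℤ), ← hgen, ← hgen'] at hc
  simp only [Int.natCast_toNat_eq_self.mpr hu0] at hc
  rw [HahnSeries.coeff_eq_zero_of_lt_order (x := g' _) (by rwa [hg']), ← hg,
    HahnSeries.coeff_order_eq_zero] at hc
  exact generic_ne_zero g _ hc

lemma agreeUpTo_of_inter_nonempty (he : AddSubmonoid.closure (Set.range e) = Λ) {s : ℕ}
    {ν ν' : NLat M} (hν : ∀ u ∈ Λ, u ≠ 0 → 0 < ν u) (hν' : ∀ u ∈ Λ, u ≠ 0 → 0 < ν' u)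
    (hne : (jetOrbit Λ s ν ∩ jetOrbit Λ s ν').Nonempty) : AgreeUpTo e s ν ν' := by
  obtain ⟨_, ⟨h, hh, rfl⟩, h', hh', hj⟩ := hne
  have hmem : ∀ i, e i ∈ Λ := fun i => he ▸ AddSubmonoid.subset_closure ⟨i, rfl⟩
  have hnn : ∀ {μ : NLat M}, (∀ u ∈ Λ, u ≠ 0 → 0 < μ u) → ∀ i, 0 ≤ μ (e i) := by
    intro μ hμ i
    by_cases h0 : e i = 0
    · simp [h0]
    · exact (hμ _ (hmem i) h0).le
  intro i hi
  have h1 := order_le_of_jet_eq hh hh' hj.symm (u := ⟨e i, hmem i⟩) (hnn hν i)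
  have h2 := order_le_of_jet_eq hh' hh hj (u := ⟨e i, hmem i⟩) (hnn hν' i)
  simp only at h1 h2
  omega

end Arcs

end ToricJets

end

theorem proposition8p3 {M : Type*} [AddCommGroup M] [Module.Free ℤ M] [Module.Finite ℤ M]
    (Λ : AddSubmonoid M) (hΛ : ToricJets.IsToricSemigroup Λ)
    {n : ℕ} (e : Fin n → M) (he : ToricJets.IsMinimalGenerators Λ e) :
    (∀ k : ℕ, k ≤ Module.finrank ℤ M → ∀ (ν ν' : ToricJets.NLat M) (s : ℕ),
      (ν, s) ∈ ToricJets.A Λ e k → (ν', s) ∈ ToricJets.A Λ e k →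
      List.TFAE [
        ToricJets.Equivalent Λ e k (ν, s) (ν', s),
        ToricJets.ell e ν s = ToricJets.ell e ν' s ∧
          ∀ x ∈ ToricJets.ell e ν s, ToricJets.toNRat ν x = ToricJets.toNRat ν' x,
        ToricJets.jetOrbit Λ s ν = ToricJets.jetOrbit Λ s ν',
        (ToricJets.jetOrbit Λ s ν ∩ ToricJets.jetOrbit Λ s ν').Nonempty]) ∧
    (∀ (ν ν' : ToricJets.NLat M) (s : ℕ),
      ToricJets.toNReal ν ∈ ToricJets.sigmaInterior Λ →
      ToricJets.toNReal ν' ∈ ToricJets.sigmaInterior Λ →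
      ToricJets.jetOrbit Λ s ν = ToricJets.jetOrbit Λ s ν' ∨
        Disjoint (ToricJets.jetOrbit Λ s ν) (ToricJets.jetOrbit Λ s ν')) := by
  have hcl := he.closure_eq
  have hpos : ∀ {ν : ToricJets.NLat M}, ToricJets.toNReal ν ∈ ToricJets.sigmaInterior Λ →
      ∀ u ∈ Λ, u ≠ 0 → 0 < ν u := fun hν _ hu hu0 =>
    ToricJets.pos_of_toNReal_mem_sigmaInterior hν hu hu0
  have heq : ∀ {ν ν' : ToricJets.NLat M} {s : ℕ},
      ToricJets.toNReal ν ∈ ToricJets.sigmaInterior Λ →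
      ToricJets.toNReal ν' ∈ ToricJets.sigmaInterior Λ → ToricJets.AgreeUpTo e s ν ν' →
      ToricJets.jetOrbit Λ s ν = ToricJets.jetOrbit Λ s ν' := fun hν hν' h =>
    (h.jetOrbit_subset hcl (hpos hν')).antisymm (h.symm.jetOrbit_subset hcl (hpos hν))
  refine ⟨fun k hk ν ν' s hA hA' => ?_, fun ν ν' s hν hν' => ?_⟩
  · tfae_have 1 → 2 := ToricJets.ell_agree_of_equivalent hΛ hcl hk hA hA'
    tfae_have 2 → 1 := fun h =>
      (ToricJets.agreeUpTo_iff.mpr h).equivalent hΛ hcl hk hA hA'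
    tfae_have 2 → 3 := fun h => heq hA.1 hA'.1 (ToricJets.agreeUpTo_iff.mpr h)
    tfae_have 3 → 4 := fun h => by
      rw [← h, Set.inter_self]
      exact ToricJets.jetOrbit_nonempty (hpos hA.1) s
    tfae_have 4 → 2 := fun h => ToricJets.agreeUpTo_iff.mp
      (ToricJets.agreeUpTo_of_inter_nonempty hcl (hpos hA.1) (hpos hA'.1) h)
    tfae_finish
  -- A common jet already forces agreement up to `s`, hence equality, without reference to `A_k`.
  · by_cases hne : (ToricJets.jetOrbit Λ s ν ∩ ToricJets.jetOrbit Λ s ν').Nonempty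
    · exact .inl (heq hν hν'
        (ToricJets.agreeUpTo_of_inter_nonempty hcl (hpos hν) (hpos hν') hne))
    · exact .inr (Set.disjoint_iff_inter_eq_empty.mpr (Set.not_nonempty_iff_eq_empty.mp hne))
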